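/- Let $k\ge 1$ be an integer and $0\le\alpha<1$, and let $\mathbb D=\{z\in\mathbb C:|z|<1\}$. Let $S_{LH}^{k*}(\alpha)$ be the class of univalent functions $f:\mathbb D\to\mathbb C$ of the form $f(z)=z\,h(z)\,\overline{g(z)}$, where $$h(z)=\exp\Big(\sum_{n=1}^\infty a_{nk}z^{nk}\Big),\qquad g(z)=\exp\Big(\sum_{n=1}^\infty b_{nk}z^{nk}\Big)$$ are analytic in $\mathbb D$, such that - $f$ is $k$-fold symmetric: $f(e^{2\pi i/k}z)=e^{2\pi i/k}f(z)$ for $z\in\mathbb D$; - $f$ is logharmonic: there is an analytic $\omega$ on $\mathbb D$ with $|\omega|<1$ and $\overline{f_{\bar z}}/\overline{f}=\omega\, f_z/f$ on $\mathbb D\setminus\{0\}$; - $f$ is starlike of order $\alpha$: $\operatorname{Re}\dfrac{z f_z(z)-\bar z f_{\bar z}(z)}{f(z)}>\alpha$ for all $z\in\mathbb D\setminus\{0\}$. **Theorem.** Let $f\in S_{LH}^{k*}(\alpha)$, let $0\le r<1$, and let $\mathbb D_r=\{z\in\mathbb C:|z|<r\}$. Then the area (planar Lebesgue measure) $Ar$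 of $f(\mathbb D_r)$ is finite and satisfies $$2\pi L_1\le Ar\le 2\pi L_2,$$ where $$L_1=\int_0^r\Big(\frac{1-(1-2\alpha)\rho^k}{(1+\rho^k)^{2(\alpha+k)/k}}\Big)^2\exp\Big(\frac{-8(1-\alpha)\rho^k}{k(1+\rho^k)}\Big)\rho\,d\rho-\int_0^r\Big(\frac{\rho^k(1+(1-2\alpha)\rho^k)}{(1-\rho^k)^{2(\alpha+k)/k}}\Big)^2\exp\Big(\frac{8(1-\alpha)\rho^k}{k(1-\rho^k)}\Big)\rho\,d\rho$$ and $$L_2=\int_0^r\Big(\frac{1+(1-2\alpha)\rho^k}{(1-\rho^k)^{2(\alpha+k)/k}}\Big)^2\exp\Big(\frac{8(1-\alpha)\rho^k}{k(1-\rho^k)}\Big)\rho\,d\rho-\int_0^r\Big(\frac{\rho^k(1-(1-2\alpha)\rho^k)}{(1+\rho^k)^{2(\alpha+k)/k}}\Big)^2\exp\Big(\frac{-8(1-\alpha)\rho^k}{k(1+\rho^k)}\Big)\rho\,d\rho.$$ -/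

import Mathlib

open scoped ComplexConjugate

noncomputable section

namespace Logharmonic

/-- The open unit disk. -/
def unitDisk : Set ℂ := Metric.ball 0 1

/-- Wirtinger derivative `f_z = (f_x - i f_y) / 2`. -/
def dz (f : ℂ → ℂ) (z : ℂ) : ℂ :=
  (fderiv ℝ f z 1 - Complex.I * fderiv ℝ f z Complex.I) / 2

/-- Wirtinger derivative `f_{z̄} = (f_x + i f_y) / 2`. -/
def dzbar (f : ℂ → ℂ) (z : ℂ) : ℂ :=
  (fderiv ℝ f z 1 + Complex.I * fderiv ℝ f z Complex.I) / 2

/-- `f` solves `conj (f_{z̄}) / conj f = ω * (f_z / f)` in the unit disk (away from the zeros of `f`,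
where the quotients are meaningless), with `ω` analytic and `|ω| < 1`; that is, `f` is logharmonic
with second dilatation `ω`. -/
def HasSecondDilatation (f ω : ℂ → ℂ) : Prop :=
  DifferentiableOn ℂ ω unitDisk ∧ (∀ z ∈ unitDisk, ‖ω z‖ < 1) ∧
    ∀ z ∈ unitDisk, f z ≠ 0 →
      DifferentiableAt ℝ f z ∧ conj (dzbar f z) / conj (f z) = ω z * (dz f z / f z)

/-- `f` is logharmonic in the unit disk. -/
def IsLogharmonic (f : ℂ → ℂ) : Prop := ∃ ω : ℂ → ℂ, HasSecondDilatation f ω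

/-- `f (e^{2πi/k} z) = e^{2πi/k} f z` in the unit disk. -/
def IsKFoldSymmetric (k : ℕ) (f : ℂ → ℂ) : Prop :=
  ∀ z ∈ unitDisk, f (Complex.exp (2 * Real.pi * Complex.I / k) * z) =
    Complex.exp (2 * Real.pi * Complex.I / k) * f z

/-- `h z = exp (∑_{n ≥ 1} a_{nk} z^{nk})` in the unit disk, the series being convergent there. -/
def IsExpKSeries (k : ℕ) (h : ℂ → ℂ) : Prop :=
  ∃ a : ℕ → ℂ, ∀ z ∈ unitDisk, ∃ s : ℂ,
    HasSum (fun n : ℕ => a ((n + 1) * k) * z ^ ((n + 1) * k)) s ∧ h z = Complex.exp s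

/-- `Re (D f / f) > α` in the punctured unit disk, where `D = z ∂/∂z - z̄ ∂/∂z̄`. -/
def IsStarlikeOfOrder (α : ℝ) (f : ℂ → ℂ) : Prop :=
  ∀ z ∈ unitDisk, z ≠ 0 → α < ((z * dz f z - conj z * dzbar f z) / f z).re

/-- The class `S_LH^{k*}(α)`: univalent, `k`-fold symmetric, logharmonic mappings of the unit disk,
starlike of order `α`, of the form `f z = z * h z * conj (g z)` with `h` and `g` exponentials of
power series in `z ^ k` without constant term. -/
structure SLHkStar (k : ℕ) (α : ℝ) (f : ℂ → ℂ) : Prop where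
  univalent : Set.InjOn f unitDisk
  symmetric : IsKFoldSymmetric k f
  logharmonic : IsLogharmonic f
  starlike : IsStarlikeOfOrder α f
  form : ∃ h g : ℂ → ℂ, DifferentiableOn ℂ h unitDisk ∧ DifferentiableOn ℂ g unitDisk ∧
    IsExpKSeries k h ∧ IsExpKSeries k g ∧ ∀ z ∈ unitDisk, f z = z * h z * conj (g z)

/-- The radial integral in the lower area bound. -/
def L₁ (k : ℕ) (α r : ℝ) : ℝ :=
  (∫ ρ in (0 : ℝ)..r,
      ((1 - (1 - 2 * α) * ρ ^ k) / (1 + ρ ^ k) ^ (2 * (α + k) / k)) ^ 2 *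
        Real.exp (-8 * (1 - α) * ρ ^ k / (k * (1 + ρ ^ k))) * ρ) -
    ∫ ρ in (0 : ℝ)..r,
      (ρ ^ k * (1 + (1 - 2 * α) * ρ ^ k) / (1 - ρ ^ k) ^ (2 * (α + k) / k)) ^ 2 *
        Real.exp (8 * (1 - α) * ρ ^ k / (k * (1 - ρ ^ k))) * ρ

/-- The radial integral in the upper area bound. -/
def L₂ (k : ℕ) (α r : ℝ) : ℝ :=
  (∫ ρ in (0 : ℝ)..r,
      ((1 + (1 - 2 * α) * ρ ^ k) / (1 - ρ ^ k) ^ (2 * (α + k) / k)) ^ 2 *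
        Real.exp (8 * (1 - α) * ρ ^ k / (k * (1 - ρ ^ k))) * ρ) -
    ∫ ρ in (0 : ℝ)..r,
      (ρ ^ k * (1 - (1 - 2 * α) * ρ ^ k) / (1 + ρ ^ k) ^ (2 * (α + k) / k)) ^ 2 *
        Real.exp (-8 * (1 - α) * ρ ^ k / (k * (1 + ρ ^ k))) * ρ

end Logharmonic

end

/-
Put `H = z f_z / f` and `G = conj (z̄ f_z̄ / f)`, which are holomorphic functions of `w = z ^ k`.
Starlikeness says that `p = H - G` has real part greater than `α`, and `|ω| < 1` says that
`q = (H + G) / (H - G)` has positive real part; both take the value `1` at the origin. The Jacobian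
is `|h g|² (|H|² - |G|²) = |h g|² |p|² re q`, so besides the classical estimates for `p` and `q` one
needs sharp growth bounds for `|h g|`, that is, for the real part of `E = k log (h g)`, which solves
`w E' = p q - 1`. Let `α = 0`. If `1 + E / 2` failed to have positive real part, then at a failure
point of minimal modulus Jack's lemma would make `p q = 1 + w E'` real and nonpositive, although
neither `p` nor `q` takes a value in the closed left half-plane. Hence `1 + E / 2` obeys the
Carathéodory bounds. For general `α`, write `p q - 1` as a convex combination of `q - 1` and
`p₀ q - 1` with `re p₀ > 0`. Integrating the resulting radial bounds for the Jacobian over the disk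
bounds the area.
-/

open Complex Metric MeasureTheory Set
open scoped Real Topology

namespace Logharmonic

/-- The Carathéodory class of order `α`: holomorphic functions of real part greater than `α` on the
unit disk, normalized by the value `1` at the origin. -/
structure IsCaratheodory (α : ℝ) (c : ℂ → ℂ) : Prop where
  differentiableOn : DifferentiableOn ℂ c (ball 0 1)
  map_zero : c 0 = 1
  lt_re : ∀ z ∈ ball (0 : ℂ) 1, α < (c z).re

namespace IsCaratheodory

variable {α : ℝ} {c : ℂ → ℂ} {z : ℂ}

lemma lt_one (hc : IsCaratheodory α c) : α < 1 := by
  simpa [hc.map_zero] using hc.lt_re 0 (mem_ball_self one_pos)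

lemma norm_sub_one_lt (hc : IsCaratheodory α c) (hz : z ∈ ball (0 : ℂ) 1) :
    ‖c z - 1‖ < ‖c z + 1 - 2 * α‖ := by
  have hre := mul_pos (sub_pos.2 (hc.lt_re z hz)) (sub_pos.2 hc.lt_one)
  rw [← sq_lt_sq₀ (norm_nonneg _) (norm_nonneg _), ← normSq_eq_norm_sq, ← normSq_eq_norm_sq,
    normSq_apply, normSq_apply]
  simp only [add_re, sub_re, one_re, mul_re, re_ofNat, ofReal_re, im_ofNat, ofReal_im, add_im,
    sub_im, one_im, mul_im]
  linarith

/-- The Schwarz lemma for the Möbius transform of `c` that maps the half-plane to the disk. -/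
lemma norm_sub_one_le_mul (hc : IsCaratheodory α c) (hz : ‖z‖ < 1) :
    ‖c z - 1‖ ≤ ‖z‖ * ‖c z + 1 - 2 * α‖ := by
  have hpos : ∀ x ∈ ball (0 : ℂ) 1, 0 < ‖c x + 1 - 2 * α‖ := fun x hx =>
    (norm_nonneg _).trans_lt (hc.norm_sub_one_lt hx)
  have hdiff : DifferentiableOn ℂ (fun x => (c x - 1) / (c x + 1 - 2 * α)) (ball 0 1) :=
    (hc.differentiableOn.sub_const _).div ((hc.differentiableOn.add_const _).sub_const _)
      fun x hx => norm_pos_iff.1 (hpos x hx)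
  have hmaps : MapsTo (fun x => (c x - 1) / (c x + 1 - 2 * α)) (ball 0 1) (closedBall 0 1) :=
    fun x hx => by
      rw [mem_closedBall_zero_iff, norm_div]
      exact div_le_one_of_le₀ (hc.norm_sub_one_lt hx).le (norm_nonneg _)
  have hschwarz := norm_le_norm_of_mapsTo_ball hdiff hmaps (by simp [hc.map_zero]) hz
  rwa [norm_div, div_le_iff₀ (hpos z (mem_ball_zero_iff.2 hz))] at hschwarz

lemma norm_sub_one_le (hc : IsCaratheodory α c) (hz : ‖z‖ < 1) :
    ‖c z - 1‖ ≤ 2 * (1 - α) * ‖z‖ / (1 - ‖z‖) := by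
  have hadd : ‖c z + 1 - 2 * α‖ ≤ ‖c z - 1‖ + 2 * (1 - α) := by
    calc ‖c z + 1 - 2 * α‖ = ‖(c z - 1) + (2 * (1 - α) : ℝ)‖ := by push_cast; ring_nf
      _ ≤ ‖c z - 1‖ + ‖((2 * (1 - α) : ℝ) : ℂ)‖ := norm_add_le _ _
      _ = ‖c z - 1‖ + 2 * (1 - α) := by
        rw [norm_real, Real.norm_of_nonneg (by linarith [hc.lt_one])]
  rw [le_div_iff₀ (sub_pos.2 hz)]
  linarith [hc.norm_sub_one_le_mul hz, mul_le_mul_of_nonneg_left hadd (norm_nonneg z)]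

lemma norm_le (hc : IsCaratheodory α c) (hz : ‖z‖ < 1) :
    ‖c z‖ ≤ (1 + (1 - 2 * α) * ‖z‖) / (1 - ‖z‖) := by
  have hne : 1 - ‖z‖ ≠ 0 := (sub_pos.2 hz).ne'
  calc ‖c z‖ ≤ ‖c z - 1‖ + ‖(1 : ℂ)‖ := by simpa using norm_add_le (c z - 1) 1
    _ ≤ 2 * (1 - α) * ‖z‖ / (1 - ‖z‖) + 1 := by
      rw [norm_one]
      gcongr
      exact hc.norm_sub_one_le hz
    _ = (1 + (1 - 2 * α) * ‖z‖) / (1 - ‖z‖) := by field_simp; ring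

lemma le_re (hc : IsCaratheodory α c) (hz : ‖z‖ < 1) :
    (1 - (1 - 2 * α) * ‖z‖) / (1 + ‖z‖) ≤ (c z).re := by
  have ht := norm_nonneg z
  have hre := hc.lt_re z (mem_ball_zero_iff.2 hz)
  have hsq : ‖c z - 1‖ ^ 2 ≤ ‖z‖ ^ 2 * ‖c z + 1 - 2 * α‖ ^ 2 := by
    rw [← mul_pow]
    gcongr
    exact hc.norm_sub_one_le_mul hz
  rw [← normSq_eq_norm_sq (c z - 1), ← normSq_eq_norm_sq (c z + 1 - 2 * α), normSq_apply,
    normSq_apply] at hsq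
  simp only [sub_re, one_re, sub_im, one_im, sub_zero, add_re, add_im, add_zero, mul_re, re_ofNat,
    ofReal_re, im_ofNat, ofReal_im, mul_zero, mul_im, zero_mul] at hsq
  have him : ‖z‖ ^ 2 * (c z).im ^ 2 ≤ (c z).im ^ 2 :=
    mul_le_of_le_one_left (sq_nonneg _) (by nlinarith)
  have habs : 1 - (c z).re ≤ ‖z‖ * ((c z).re + 1 - 2 * α) := by
    refine le_of_abs_le (abs_le_of_sq_le_sq ?_ (mul_nonneg ht (by linarith [hc.lt_one])))
    linarith
  rw [div_le_iff₀ (by positivity)]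
  linarith

lemma re_sub_one_le (hc : IsCaratheodory α c) (hz : ‖z‖ < 1) :
    (c z - 1).re ≤ 2 * (1 - α) * ‖z‖ / (1 - ‖z‖) :=
  (re_le_norm _).trans (hc.norm_sub_one_le hz)

lemma le_re_sub_one (hc : IsCaratheodory α c) (hz : ‖z‖ < 1) :
    -(2 * (1 - α) * ‖z‖ / (1 + ‖z‖)) ≤ (c z - 1).re := by
  have hne : 1 + ‖z‖ ≠ 0 := by positivity
  calc -(2 * (1 - α) * ‖z‖ / (1 + ‖z‖)) = (1 - (1 - 2 * α) * ‖z‖) / (1 + ‖z‖) - 1 := by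
        field_simp; ring
    _ ≤ (c z - 1).re := by simpa using hc.le_re hz

end IsCaratheodory

section BoundaryPoint

variable {c : ℂ → ℂ} {m : ℂ}

lemma mem_posTangentConeAt_ball_one (y : ℝ) : -1 + y * I ∈ posTangentConeAt (ball (0 : ℂ) 1) 1 := by
  refine mem_posTangentConeAt_of_frequently_mem (Filter.Eventually.frequently ?_)
  filter_upwards [Ioo_mem_nhdsGT (show (0 : ℝ) < 2 / (1 + y ^ 2) by positivity)] with t ⟨ht, hty⟩
  rw [lt_div_iff₀ (by positivity)] at hty
  rw [mem_ball_zero_iff, ← sq_lt_one_iff₀ (norm_nonneg _), ← normSq_eq_norm_sq, normSq_apply]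
  simp only [real_smul, add_re, one_re, mul_re, ofReal_re, neg_re, I_re, ofReal_im, I_im, add_im,
    one_im, mul_im, neg_im]
  nlinarith

lemma im_eq_zero_of_re_pos_of_hasDerivAt (hpos : ∀ ζ ∈ ball (0 : ℂ) 1, 0 < (c ζ).re)
    (hm : HasDerivAt c m 1) (h1 : (c 1).re ≤ 0) : m.im = 0 := by
  have hmin : IsLocalMinOn (fun ζ => (c ζ).re) (ball 0 1) 1 :=
    Filter.eventually_of_mem self_mem_nhdsWithin fun ζ hζ => h1.trans (hpos ζ hζ).le
  have hre (y : ℝ) : 0 ≤ -m.re - y * m.im := by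
    simpa [sub_eq_add_neg] using hmin.hasFDerivWithinAt_nonneg
      (reCLM.hasFDerivAt.comp (1 : ℂ) (hm.hasFDerivAt.restrictScalars ℝ)).hasFDerivWithinAt
      (mem_posTangentConeAt_ball_one y)
  by_contra him
  have := hre ((1 - m.re) / m.im)
  rw [div_mul_cancel₀ _ him] at this
  linarith

/-- The constant is the derivative at `1` of the extremal function `(1 - z) / (1 + z)`. -/
lemma IsCaratheodory.re_le_of_hasDerivAt (hc : IsCaratheodory 0 c)
    (hm : HasDerivAt c m 1) (h1 : (c 1).re ≤ 0) : m.re ≤ -1 / 2 := by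
  have hre : HasDerivAt (fun s : ℝ => (c s).re) m.re 1 :=
    HasDerivAt.real_of_complex (z := 1) (by simpa using hm)
  have hext : HasDerivAt (fun s : ℝ => (1 - s) / (1 + s)) (-1 / 2) 1 :=
    (((hasDerivAt_id' (1 : ℝ)).const_sub 1).div ((hasDerivAt_id' (1 : ℝ)).const_add 1)
      (by norm_num)).congr_deriv (by norm_num)
  have hmin : IsLocalMinOn (fun s : ℝ => (c s).re - (1 - s) / (1 + s)) (Ioo 0 1) 1 := by
    refine Filter.eventually_of_mem self_mem_nhdsWithin fun s hs => ?_
    have hns : ‖(s : ℂ)‖ = s := by rw [norm_real, Real.norm_of_nonneg hs.1.le]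
    have hle := hc.le_re (hns.trans_lt hs.2)
    rw [hns, mul_zero, sub_zero, one_mul] at hle
    have h1' : (c ((1 : ℝ) : ℂ)).re ≤ 0 := by simpa using h1
    simpa using h1'.trans (sub_nonneg.2 hle)
  have hcone : (0 : ℝ) - 1 ∈ posTangentConeAt (Ioo (0 : ℝ) 1) 1 :=
    sub_mem_posTangentConeAt_of_openSegment_subset
      (by rw [openSegment_symm, openSegment_eq_Ioo one_pos])
  have := hmin.hasFDerivWithinAt_nonneg (hre.sub hext).hasFDerivAt.hasFDerivWithinAt hcone
  simp only [ContinuousLinearMap.toSpanSingleton_apply, zero_sub, smul_eq_mul] at this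
  linarith

lemma exists_re_nonpos_isCaratheodory_comp_mul {z₁ : ℂ} (hc : DifferentiableOn ℂ c (ball 0 1))
    (hc0 : c 0 = 1) (hz₁ : z₁ ∈ ball (0 : ℂ) 1) (hre₁ : (c z₁).re ≤ 0) :
    ∃ z ∈ ball (0 : ℂ) 1, (c z).re ≤ 0 ∧ IsCaratheodory 0 (fun ζ => c (z * ζ)) := by
  have hsub : closedBall (0 : ℂ) ‖z₁‖ ⊆ ball 0 1 := closedBall_subset_ball (mem_ball_zero_iff.1 hz₁)
  have hcpt : IsCompact (closedBall (0 : ℂ) ‖z₁‖ ∩ (fun z => (c z).re) ⁻¹' Iic 0) :=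
    (isCompact_closedBall 0 ‖z₁‖).of_isClosed_subset
      ((continuous_re.comp_continuousOn (hc.continuousOn.mono hsub)).preimage_isClosed_of_isClosed
        isClosed_closedBall isClosed_Iic) inter_subset_left
  obtain ⟨z, ⟨hz₁', hre⟩, hmin⟩ :=
    hcpt.exists_isMinOn ⟨z₁, by simp, hre₁⟩ continuous_norm.continuousOn
  have hz := hsub hz₁'
  rw [mem_closedBall_zero_iff] at hz₁'
  have hz0 : 0 < ‖z‖ := norm_pos_iff.2 <| by
    rintro rfl
    exact zero_lt_one.not_ge (by simpa [hc0] using hre)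
  have hlt : ∀ ζ ∈ ball (0 : ℂ) 1, ‖z * ζ‖ < ‖z‖ := fun ζ hζ => by
    rw [norm_mul]
    exact mul_lt_of_lt_one_right hz0 (mem_ball_zero_iff.1 hζ)
  refine ⟨z, hz, hre, hc.comp (by fun_prop) fun ζ hζ => ?_, by simp [hc0], fun ζ hζ => ?_⟩
  · exact mem_ball_zero_iff.2 ((hlt ζ hζ).trans (mem_ball_zero_iff.1 hz))
  · by_contra! hle
    exact (hmin ⟨mem_closedBall_zero_iff.2 ((hlt ζ hζ).le.trans hz₁'), hle⟩).not_gt (hlt ζ hζ)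

/-- Jack's lemma, in the form of Miller and Mocanu: at a point `z` of minimal modulus with
`re (c z) ≤ 0`, the derivative of `ζ ↦ c (z * ζ)` at `1` is real and at most `-1 / 2`. -/
theorem isCaratheodory_of_mul_deriv_ne (hc : DifferentiableOn ℂ c (ball 0 1)) (hc0 : c 0 = 1)
    (hne : ∀ z ∈ ball (0 : ℂ) 1, ∀ x : ℝ, x ≤ -1 / 2 → z * deriv c z ≠ x) :
    IsCaratheodory 0 c := by
  refine ⟨hc, hc0, ?_⟩
  by_contra! ⟨z₁, hz₁, hre₁⟩
  obtain ⟨z, hz, hre, hcz⟩ := exists_re_nonpos_isCaratheodory_comp_mul hc hc0 hz₁ hre₁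
  have hre' : (c (z * 1)).re ≤ 0 := by rwa [mul_one]
  have hderiv : HasDerivAt (fun ζ => c (z * ζ)) (z * deriv c z) 1 := by
    have hcd := (hc.differentiableAt (isOpen_ball.mem_nhds hz)).hasDerivAt
    rw [← mul_one z] at hcd
    exact (hcd.comp 1 ((hasDerivAt_id' (1 : ℂ)).const_mul z)).congr_deriv (by simp [mul_comm])
  exact hne z hz (z * deriv c z).re (hcz.re_le_of_hasDerivAt hderiv hre')
    (Complex.ext rfl (by simpa using im_eq_zero_of_re_pos_of_hasDerivAt hcz.lt_re hderiv hre'))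

end BoundaryPoint

/-- `E` is the solution on the unit disk of `z E' = F - 1`, `E 0 = 0`; equivalently, `F` is the
logarithmic derivative `z g' / g` of `g z = z * exp (E z)`. -/
structure IsRadialPrimitive (F E : ℂ → ℂ) : Prop where
  differentiableOn : DifferentiableOn ℂ E (ball 0 1)
  map_zero : E 0 = 0
  mul_deriv : ∀ z ∈ ball (0 : ℂ) 1, z * deriv E z = F z - 1

namespace IsRadialPrimitive

variable {F E : ℂ → ℂ} {w : ℂ}

lemma hasDerivAt (hE : IsRadialPrimitive F E) (hw : w ∈ ball (0 : ℂ) 1) :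
    HasDerivAt E (deriv E w) w :=
  (hE.differentiableOn.differentiableAt (isOpen_ball.mem_nhds hw)).hasDerivAt

lemma exists_of_differentiableOn (hF : DifferentiableOn ℂ F (ball 0 1)) (hF0 : F 0 = 1) :
    ∃ E, IsRadialPrimitive F E := by
  obtain ⟨V, hV⟩ := ((differentiableOn_dslope (ball_mem_nhds 0 one_pos)).2 hF).isExactOn_ball
  refine ⟨fun z => V z - V 0,
    fun z hz => ((hV z hz).sub_const _).differentiableAt.differentiableWithinAt, sub_self _,
    fun z hz => ?_⟩
  rw [((hV z hz).sub_const _).deriv]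
  simpa [hF0] using sub_smul_dslope F 0 z

/-- Along a ray the radial derivative of `re E` at modulus `s` is `re (F - 1) / s`. -/
lemma re_le_sub (hE : IsRadialPrimitive F E) {U U' : ℝ → ℝ}
    (hU : ∀ s ∈ Ico (0 : ℝ) 1, HasDerivAt U (U' s) s)
    (hle : ∀ z ∈ ball (0 : ℂ) 1, (F z - 1).re ≤ ‖z‖ * U' ‖z‖) (hw : w ∈ ball (0 : ℂ) 1) :
    (E w).re ≤ U ‖w‖ - U 0 := by
  have hnorm {s : ℝ} (hs : s ∈ Icc (0 : ℝ) 1) : ‖s * w‖ = s * ‖w‖ := by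
    rw [norm_mul, norm_real, Real.norm_of_nonneg hs.1]
  have hmem {s : ℝ} (hs : s ∈ Icc (0 : ℝ) 1) : s * w ∈ ball (0 : ℂ) 1 := by
    rw [mem_ball_zero_iff] at hw ⊢
    exact (hnorm hs).trans_lt ((mul_le_of_le_one_left (norm_nonneg _) hs.2).trans_lt hw)
  have hderiv {s : ℝ} (hs : s ∈ Icc (0 : ℝ) 1) :
      HasDerivAt (fun s : ℝ => U (s * ‖w‖) - (E (s * w)).re)
        (U' (s * ‖w‖) * ‖w‖ - (deriv E (s * w) * w).re) s := by
    have hUs := hU (s * ‖w‖) ⟨mul_nonneg hs.1 (norm_nonneg _), by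
      rw [← hnorm hs]; exact mem_ball_zero_iff.1 (hmem hs)⟩
    have hEs := (hE.hasDerivAt (hmem hs)).comp (s : ℂ) (hasDerivAt_mul_const w)
    exact (hUs.comp s (hasDerivAt_mul_const ‖w‖)).sub hEs.real_of_complex
  have hmono : MonotoneOn (fun s : ℝ => U (s * ‖w‖) - (E (s * w)).re) (Icc 0 1) := by
    refine monotoneOn_of_hasDerivWithinAt_nonneg (convex_Icc 0 1)
      (fun s hs => (hderiv hs).continuousAt.continuousWithinAt)
      (fun s hs => (hderiv (interior_subset hs)).hasDerivWithinAt) fun s hs => ?_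
    rw [interior_Icc] at hs
    have hs' := Ioo_subset_Icc_self hs
    have hFs := hle _ (hmem hs')
    rw [← hE.mul_deriv _ (hmem hs'), hnorm hs', mul_assoc, re_ofReal_mul, mul_comm w] at hFs
    rw [sub_nonneg]
    refine le_of_mul_le_mul_left ?_ hs.1
    linarith
  have := hmono (left_mem_Icc.2 zero_le_one) (right_mem_Icc.2 zero_le_one) zero_le_one
  simp only [ofReal_zero, zero_mul, hE.map_zero, zero_re, ofReal_one, one_mul] at this
  linarith

lemma two_sub (hE : IsRadialPrimitive F E) :
    IsRadialPrimitive (fun z => 2 - F z) (fun z => -E z) where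
  differentiableOn := hE.differentiableOn.neg
  map_zero := by rw [hE.map_zero, neg_zero]
  mul_deriv z hz := by
    rw [deriv.fun_neg]
    linear_combination -hE.mul_deriv z hz

lemma sub_le_re (hE : IsRadialPrimitive F E) {U U' : ℝ → ℝ}
    (hU : ∀ s ∈ Ico (0 : ℝ) 1, HasDerivAt U (U' s) s)
    (hle : ∀ z ∈ ball (0 : ℂ) 1, ‖z‖ * U' ‖z‖ ≤ (F z - 1).re) (hw : w ∈ ball (0 : ℂ) 1) :
    U ‖w‖ - U 0 ≤ (E w).re := by
  have := hE.two_sub.re_le_sub (fun s hs => (hU s hs).neg) (fun z hz => ?_) hw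
  · simp only [Pi.neg_apply, neg_re] at this
    linarith
  · have := hle z hz
    simp only [sub_re, re_ofNat, one_re] at this ⊢
    linarith

end IsRadialPrimitive

lemma mul_ne_ofReal_of_nonpos {a b : ℂ} (ha : 0 < a.re) (hb : 0 < b.re) {x : ℝ} (hx : x ≤ 0) :
    a * b ≠ x := by
  intro hab
  have hconj : a * (normSq b : ℝ) = x * conj b := by
    rw [← mul_conj, ← mul_assoc, hab]
  have hre := congrArg re hconj
  rw [re_mul_ofReal, re_ofReal_mul, conj_re] at hre
  have hb' : 0 < normSq b := normSq_pos.2 fun h => hb.ne' (by simp [h])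
  nlinarith [mul_pos ha hb', mul_nonneg (neg_nonneg.2 hx) hb.le]

namespace IsCaratheodory

variable {α : ℝ} {c p q E : ℂ → ℂ} {w : ℂ}

lemma re_primitive_le (hc : IsCaratheodory α c) (hE : IsRadialPrimitive c E)
    (hw : w ∈ ball (0 : ℂ) 1) : (E w).re ≤ -(2 * (1 - α) * Real.log (1 - ‖w‖)) := by
  have hU (s : ℝ) (hs : s ∈ Ico (0 : ℝ) 1) : HasDerivAt
      (fun s => -(2 * (1 - α) * Real.log (1 - s))) (2 * (1 - α) / (1 - s)) s :=
    ((((hasDerivAt_id' s).const_sub 1).log (sub_pos.2 hs.2).ne').const_mul _).neg.congr_deriv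
      (by ring)
  have := hE.re_le_sub hU (fun z hz => ?_) hw
  · simpa using this
  · exact (hc.re_sub_one_le (mem_ball_zero_iff.1 hz)).trans_eq (by ring)

lemma le_re_primitive (hc : IsCaratheodory α c) (hE : IsRadialPrimitive c E)
    (hw : w ∈ ball (0 : ℂ) 1) : -(2 * (1 - α) * Real.log (1 + ‖w‖)) ≤ (E w).re := by
  have hU (s : ℝ) (hs : s ∈ Ico (0 : ℝ) 1) : HasDerivAt
      (fun s => -(2 * (1 - α) * Real.log (1 + s))) (-(2 * (1 - α) / (1 + s))) s :=
    ((((hasDerivAt_id' s).const_add 1).log (by linarith [hs.1])).const_mul _).neg.congr_deriv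
      (by ring)
  have := hE.sub_le_re hU (fun z hz => ?_) hw
  · simpa using this
  · exact (by ring : _ = _).trans_le (hc.le_re_sub_one (mem_ball_zero_iff.1 hz))

/-- This is the step that makes the bounds for products as good as those for a single Carathéodory
function: at a boundary point of Jack's lemma, `p z * q z` would be real and nonpositive. -/
theorem one_add_primitive_mul (hp : IsCaratheodory 0 p) (hq : IsCaratheodory 0 q)
    (hE : IsRadialPrimitive (fun z => p z * q z) E) : IsCaratheodory 0 (fun z => 1 + E z / 2) := by
  refine isCaratheodory_of_mul_deriv_ne ((hE.differentiableOn.div_const 2).const_add 1)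
    (by simp [hE.map_zero]) fun z hz x hx hzx => ?_
  refine mul_ne_ofReal_of_nonpos (hp.lt_re z hz) (hq.lt_re z hz) (x := 1 + 2 * x) (by linarith) ?_
  rw [(((hE.hasDerivAt hz).div_const 2).const_add 1).deriv] at hzx
  push_cast
  linear_combination 2 * hzx - hE.mul_deriv z hz

lemma sub_div_one_sub (hc : IsCaratheodory α c) :
    IsCaratheodory 0 (fun z => (c z - α) / ((1 - α : ℝ) : ℂ)) where
  differentiableOn := (hc.differentiableOn.sub_const _).div_const _
  map_zero := by
    have : ((1 - α : ℝ) : ℂ) ≠ 0 := ofReal_ne_zero.2 (sub_pos.2 hc.lt_one).ne'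
    rw [hc.map_zero, div_eq_one_iff_eq this]
    push_cast
    rfl
  lt_re z hz := by
    rw [div_ofReal_re, sub_re, ofReal_re]
    exact div_pos (sub_pos.2 (hc.lt_re z hz)) (sub_pos.2 hc.lt_one)

/-- `c * q - 1 = α * (q - 1) + (1 - α) * (p * q - 1)` where `p = (c - α) / (1 - α)`. -/
lemma exists_primitive_mul_eq (hc : IsCaratheodory α c) (hq : IsCaratheodory 0 q)
    (hE : IsRadialPrimitive (fun z => c z * q z) E) :
    ∃ E₁ E₂, IsRadialPrimitive (fun z => (c z - α) / ((1 - α : ℝ) : ℂ) * q z) E₁ ∧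
      IsRadialPrimitive q E₂ ∧ ∀ w, (E w).re = (1 - α) * (E₁ w).re + α * (E₂ w).re := by
  obtain ⟨E₂, hE₂⟩ := IsRadialPrimitive.exists_of_differentiableOn hq.differentiableOn hq.map_zero
  have h1α : ((1 - α : ℝ) : ℂ) ≠ 0 := ofReal_ne_zero.2 (sub_pos.2 hc.lt_one).ne'
  refine ⟨fun w => (E w - α * E₂ w) / ((1 - α : ℝ) : ℂ), E₂,
    ⟨(hE.differentiableOn.sub (hE₂.differentiableOn.const_mul _)).div_const _, ?_, ?_⟩, hE₂, ?_⟩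
  · simp [hE.map_zero, hE₂.map_zero]
  · intro z hz
    have hderiv := (((hE.hasDerivAt hz).fun_sub
      ((hE₂.hasDerivAt hz).const_mul (α : ℂ))).div_const ((1 - α : ℝ) : ℂ)).deriv
    rw [hderiv]
    field_simp
    push_cast
    linear_combination hE.mul_deriv z hz - α * hE₂.mul_deriv z hz
  · intro w
    rw [div_ofReal_re, mul_div_cancel₀ _ (sub_pos.2 hc.lt_one).ne', sub_re, re_ofReal_mul,
      sub_add_cancel]

lemma re_primitive_mul_le (hα : 0 ≤ α) (hc : IsCaratheodory α c) (hq : IsCaratheodory 0 q)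
    (hE : IsRadialPrimitive (fun z => c z * q z) E) (hw : w ∈ ball (0 : ℂ) 1) :
    (E w).re ≤ 4 * (1 - α) * ‖w‖ / (1 - ‖w‖) - 2 * α * Real.log (1 - ‖w‖) := by
  obtain ⟨E₁, E₂, hE₁, hE₂, hre⟩ := hc.exists_primitive_mul_eq hq hE
  have h₁ := (one_add_primitive_mul hc.sub_div_one_sub hq hE₁).re_sub_one_le
    (mem_ball_zero_iff.1 hw)
  rw [add_sub_cancel_left, div_ofNat_re] at h₁
  rw [hre]
  linear_combination 2 * mul_le_mul_of_nonneg_left h₁ (sub_nonneg.2 hc.lt_one.le) +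
    mul_le_mul_of_nonneg_left (hq.re_primitive_le hE₂ hw) hα

lemma le_re_primitive_mul (hα : 0 ≤ α) (hc : IsCaratheodory α c) (hq : IsCaratheodory 0 q)
    (hE : IsRadialPrimitive (fun z => c z * q z) E) (hw : w ∈ ball (0 : ℂ) 1) :
    -(4 * (1 - α) * ‖w‖ / (1 + ‖w‖)) - 2 * α * Real.log (1 + ‖w‖) ≤ (E w).re := by
  obtain ⟨E₁, E₂, hE₁, hE₂, hre⟩ := hc.exists_primitive_mul_eq hq hE
  have h₁ := (one_add_primitive_mul hc.sub_div_one_sub hq hE₁).le_re_sub_one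
    (mem_ball_zero_iff.1 hw)
  rw [add_sub_cancel_left, div_ofNat_re] at h₁
  rw [hre]
  linear_combination 2 * mul_le_mul_of_nonneg_left h₁ (sub_nonneg.2 hc.lt_one.le) +
    mul_le_mul_of_nonneg_left (hq.le_re_primitive hE₂ hw) hα

end IsCaratheodory

/-- `H` and `G` stand for the logarithmic derivatives `H = z f_z / f` and `G = conj (z̄ f_z̄ / f)`
of a logharmonic mapping starlike of order `α`: the condition `α < re (H - G)` is starlikeness, and
`‖G‖ < ‖H‖` says that the second dilatation has modulus less than one. -/
structure IsStarlikePair (α : ℝ) (H G : ℂ → ℂ) : Prop where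
  differentiableOn_left : DifferentiableOn ℂ H (ball 0 1)
  differentiableOn_right : DifferentiableOn ℂ G (ball 0 1)
  map_zero_left : H 0 = 1
  map_zero_right : G 0 = 0
  lt_re_sub : ∀ z ∈ ball (0 : ℂ) 1, α < (H z - G z).re
  norm_lt_norm : ∀ z ∈ ball (0 : ℂ) 1, ‖G z‖ < ‖H z‖

namespace IsStarlikePair

variable {α : ℝ} {H G : ℂ → ℂ} {w : ℂ}

lemma isCaratheodory_sub (h : IsStarlikePair α H G) : IsCaratheodory α (fun z => H z - G z) where
  differentiableOn := h.differentiableOn_left.sub h.differentiableOn_right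
  map_zero := by rw [h.map_zero_left, h.map_zero_right, sub_zero]
  lt_re := h.lt_re_sub

lemma sub_ne_zero (h : IsStarlikePair α H G) (hw : w ∈ ball (0 : ℂ) 1) : H w - G w ≠ 0 :=
  sub_ne_zero_of_ne fun heq => (h.norm_lt_norm w hw).ne (by rw [heq])

lemma sq_norm_sub_sq_norm (h : IsStarlikePair α H G) (hw : w ∈ ball (0 : ℂ) 1) :
    ‖H w‖ ^ 2 - ‖G w‖ ^ 2 = ‖H w - G w‖ ^ 2 * ((H w + G w) / (H w - G w)).re := by
  have hne : ‖H w - G w‖ ≠ 0 := norm_ne_zero_iff.2 (h.sub_ne_zero hw)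
  rw [div_re, normSq_eq_norm_sq, ← add_div, mul_div_cancel₀ _ (pow_ne_zero 2 hne),
    ← normSq_eq_norm_sq, ← normSq_eq_norm_sq, normSq_apply, normSq_apply, add_re, add_im, sub_re,
    sub_im]
  ring

lemma isCaratheodory_add_div_sub (h : IsStarlikePair α H G) :
    IsCaratheodory 0 (fun z => (H z + G z) / (H z - G z)) where
  differentiableOn := (h.differentiableOn_left.add h.differentiableOn_right).div
    (h.differentiableOn_left.sub h.differentiableOn_right) fun _ hz => h.sub_ne_zero hz
  map_zero := by rw [h.map_zero_left, h.map_zero_right, add_zero, sub_zero, div_one]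
  lt_re z hz := by
    have hlt := pow_lt_pow_left₀ (h.norm_lt_norm z hz) (norm_nonneg _) two_ne_zero
    rw [← sub_pos, h.sq_norm_sub_sq_norm hz] at hlt
    exact pos_of_mul_pos_right hlt (sq_nonneg _)

lemma sub_mul_add_div_sub (h : IsStarlikePair α H G) (hw : w ∈ ball (0 : ℂ) 1) :
    (H w - G w) * ((H w + G w) / (H w - G w)) = H w + G w :=
  mul_div_cancel₀ _ (h.sub_ne_zero hw)

lemma norm_right_le (h : IsStarlikePair α H G) (hw : w ∈ ball (0 : ℂ) 1) :
    ‖G w‖ ≤ ‖w‖ * ((1 + (1 - 2 * α) * ‖w‖) / (1 - ‖w‖) ^ 2) := by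
  have hw' := mem_ball_zero_iff.1 hw
  have hP := h.isCaratheodory_sub.norm_le hw'
  have hq := h.isCaratheodory_add_div_sub.norm_sub_one_le hw'
  have hG : G w = (H w - G w) * ((H w + G w) / (H w - G w) - 1) / 2 := by
    linear_combination -h.sub_mul_add_div_sub hw / 2
  have hne : 1 - ‖w‖ ≠ 0 := (sub_pos.2 hw').ne'
  calc ‖G w‖ = ‖H w - G w‖ * ‖(H w + G w) / (H w - G w) - 1‖ / 2 := by
        conv_lhs => rw [hG, norm_div, norm_mul, norm_ofNat]
    _ ≤ (1 + (1 - 2 * α) * ‖w‖) / (1 - ‖w‖) * (2 * (1 - 0) * ‖w‖ / (1 - ‖w‖)) / 2 := by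
        gcongr
        exact (norm_nonneg _).trans hP
    _ = ‖w‖ * ((1 + (1 - 2 * α) * ‖w‖) / (1 - ‖w‖) ^ 2) := by field_simp; ring

lemma le_norm_left (h : IsStarlikePair α H G) (hw : w ∈ ball (0 : ℂ) 1) :
    (1 - (1 - 2 * α) * ‖w‖) / (1 + ‖w‖) ^ 2 ≤ ‖H w‖ := by
  have hw' := mem_ball_zero_iff.1 hw
  have hP := (h.isCaratheodory_sub.le_re hw').trans (re_le_norm _)
  have hq := h.isCaratheodory_add_div_sub.le_re hw'
  have hH : H w = (H w - G w) * ((H w + G w) / (H w - G w) + 1) / 2 := by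
    linear_combination -h.sub_mul_add_div_sub hw / 2
  have hq1 : (1 - (1 - 2 * 0) * ‖w‖) / (1 + ‖w‖) + 1 ≤ ‖(H w + G w) / (H w - G w) + 1‖ :=
    (add_le_add_left hq 1).trans <| by
      simpa only [add_re, one_re] using re_le_norm ((H w + G w) / (H w - G w) + 1)
  calc (1 - (1 - 2 * α) * ‖w‖) / (1 + ‖w‖) ^ 2
      = (1 - (1 - 2 * α) * ‖w‖) / (1 + ‖w‖) *
          ((1 - (1 - 2 * 0) * ‖w‖) / (1 + ‖w‖) + 1) / 2 := by field_simp; ring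
    _ ≤ ‖H w - G w‖ * ‖(H w + G w) / (H w - G w) + 1‖ / 2 := by
        gcongr
        have : (1 - (1 - 2 * 0) * ‖w‖) / (1 + ‖w‖) + 1 = 2 / (1 + ‖w‖) := by field_simp; ring
        rw [this]
        positivity
    _ = ‖H w‖ := by conv_rhs => rw [hH, norm_div, norm_mul, norm_ofNat]

lemma sq_norm_sub_sq_norm_le (h : IsStarlikePair α H G) (hw : w ∈ ball (0 : ℂ) 1) :
    ‖H w‖ ^ 2 - ‖G w‖ ^ 2 ≤
      ((1 + (1 - 2 * α) * ‖w‖) / (1 - ‖w‖) ^ 2) ^ 2 * (1 - ‖w‖ ^ 2) := by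
  have hw' := mem_ball_zero_iff.1 hw
  have hne : 1 - ‖w‖ ≠ 0 := (sub_pos.2 hw').ne'
  have hP := h.isCaratheodory_sub.norm_le hw'
  have hq := (re_le_norm _).trans (h.isCaratheodory_add_div_sub.norm_le hw')
  have hq₀ := (h.isCaratheodory_add_div_sub.lt_re w hw).le
  calc ‖H w‖ ^ 2 - ‖G w‖ ^ 2
      = ‖H w - G w‖ ^ 2 * ((H w + G w) / (H w - G w)).re := h.sq_norm_sub_sq_norm hw
    _ ≤ ((1 + (1 - 2 * α) * ‖w‖) / (1 - ‖w‖)) ^ 2 *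
          ((1 + (1 - 2 * 0) * ‖w‖) / (1 - ‖w‖)) := by gcongr
    _ = _ := by field_simp; ring

lemma isRadialPrimitive_sub_mul (h : IsStarlikePair α H G) {E : ℂ → ℂ}
    (hE : IsRadialPrimitive (fun z => H z + G z) E) :
    IsRadialPrimitive (fun z => (H z - G z) * ((H z + G z) / (H z - G z))) E :=
  ⟨hE.differentiableOn, hE.map_zero, fun z hz => by
    rw [hE.mul_deriv z hz, h.sub_mul_add_div_sub hz]⟩

end IsStarlikePair

section Wirtinger

variable {m g : ℂ → ℂ} {m' g' z : ℂ}

lemma det_fderiv_eq_sq_norm_dz_sub_sq_norm_dzbar (f : ℂ → ℂ) (z : ℂ) :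
    (fderiv ℝ f z).det = ‖dz f z‖ ^ 2 - ‖dzbar f z‖ ^ 2 := by
  rw [ContinuousLinearMap.det, ← LinearMap.det_toMatrix basisOneI, Matrix.det_fin_two, dz, dzbar,
    ← normSq_eq_norm_sq, ← normSq_eq_norm_sq, normSq_apply, normSq_apply]
  simp only [LinearMap.toMatrix_apply, coe_basisOneI, Matrix.cons_val_zero,
    ContinuousLinearMap.coe_coe, coe_basisOneI_repr, Matrix.cons_val_one, Matrix.cons_val_fin_one,
    div_ofNat_re, sub_re, mul_re, I_re, I_im, div_ofNat_im, sub_im, mul_im, add_re, add_im]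
  ring

lemma hasFDerivAt_mul_conj (hm : HasDerivAt m m' z) (hg : HasDerivAt g g' z) :
    HasFDerivAt (fun x => m x * conj (g x))
      ((m' * conj (g z)) • ContinuousLinearMap.id ℝ ℂ +
        (m z * conj g') • (conjCLE : ℂ →L[ℝ] ℂ)) z := by
  have hgc := (conjCLE : ℂ →L[ℝ] ℂ).hasFDerivAt.comp z (hg.hasFDerivAt.restrictScalars ℝ)
  refine ((hm.hasFDerivAt.restrictScalars ℝ).mul hgc).congr_fderiv ?_
  ext v
  simp only [ContinuousLinearEquiv.coe_coe, ContinuousAlgEquiv.coe_coeCLE, Function.comp_apply,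
    conjCAE_apply, add_apply, smul_apply, ContinuousLinearMap.comp_apply,
    ContinuousLinearMap.coe_restrictScalars', ContinuousLinearMap.toSpanSingleton_apply,
    smul_eq_mul, ContinuousAlgEquiv.coeCLE_apply, map_mul, ContinuousLinearMap.id_apply]
  ring

lemma dz_mul_conj (hm : HasDerivAt m m' z) (hg : HasDerivAt g g' z) :
    dz (fun x => m x * conj (g x)) z = m' * conj (g z) := by
  rw [dz, (hasFDerivAt_mul_conj hm hg).fderiv]
  simp only [add_apply, smul_apply, ContinuousLinearMap.id_apply, smul_eq_mul, mul_one,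
    ContinuousLinearEquiv.coe_coe, ContinuousAlgEquiv.coeCLE_apply, conjCAE_apply, map_one, conj_I]
  linear_combination (m z * conj g' - m' * conj (g z)) / 2 * I_sq

lemma dzbar_mul_conj (hm : HasDerivAt m m' z) (hg : HasDerivAt g g' z) :
    dzbar (fun x => m x * conj (g x)) z = m z * conj g' := by
  rw [dzbar, (hasFDerivAt_mul_conj hm hg).fderiv]
  simp only [add_apply, smul_apply, ContinuousLinearMap.id_apply, smul_eq_mul, mul_one,
    ContinuousLinearEquiv.coe_coe, ContinuousAlgEquiv.coeCLE_apply, conjCAE_apply, map_one, conj_I]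
  linear_combination (m' * conj (g z) - m z * conj g') / 2 * I_sq

end Wirtinger

lemma pow_mem_ball_zero_one_iff {k : ℕ} (hk : 1 ≤ k) {z : ℂ} :
    z ^ k ∈ ball (0 : ℂ) 1 ↔ z ∈ ball (0 : ℂ) 1 := by
  rw [mem_ball_zero_iff, mem_ball_zero_iff, norm_pow,
    pow_lt_one_iff_of_nonneg (norm_nonneg _) (by lia)]

lemma norm_pow_mem_Ioo {k : ℕ} (hk : 1 ≤ k) {z : ℂ} (hz : z ∈ ball (0 : ℂ) 1) :
    ‖z ^ k‖ ∈ Ioo (-1 : ℝ) 1 :=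
  ⟨by linarith [norm_nonneg (z ^ k)], mem_ball_zero_iff.1 ((pow_mem_ball_zero_one_iff hk).2 hz)⟩

lemma exists_mem_ball_pow_eq {k : ℕ} (hk : 1 ≤ k) {w : ℂ} (hw : w ∈ ball (0 : ℂ) 1) :
    ∃ z ∈ ball (0 : ℂ) 1, z ^ k = w := by
  obtain ⟨z, rfl⟩ := IsAlgClosed.exists_pow_nat_eq w hk
  exact ⟨z, (pow_mem_ball_zero_one_iff hk).1 hw, rfl⟩

lemma differentiableOn_tsum_mul_pow {a : ℕ → ℂ} {m : ℕ → ℕ}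
    (ha : ∀ w ∈ ball (0 : ℂ) 1, Summable fun n => a n * w ^ m n) :
    DifferentiableOn ℂ (fun w => ∑' n, a n * w ^ m n) (ball 0 1) := by
  intro w hw
  obtain ⟨r, hwr, hr1⟩ := exists_between (mem_ball_zero_iff.1 hw)
  have hr : ‖(r : ℂ)‖ = r := by
    rw [norm_real, Real.norm_of_nonneg ((norm_nonneg _).trans hwr.le)]
  have hdiff : DifferentiableOn ℂ (fun w => ∑' n, a n * w ^ m n) (ball 0 r) := by
    refine differentiableOn_tsum_of_summable_norm
      (ha r (mem_ball_zero_iff.2 (hr.trans_lt hr1))).norm (fun n => by fun_prop) isOpen_ball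
      fun n x hx => ?_
    rw [norm_mul, norm_mul, norm_pow, norm_pow, hr]
    gcongr
    exact (mem_ball_zero_iff.1 hx).le
  exact (hdiff.differentiableAt
    (isOpen_ball.mem_nhds (mem_ball_zero_iff.2 hwr))).differentiableWithinAt

lemma IsExpKSeries.exists_eq_exp {k : ℕ} (hk : 1 ≤ k) {h : ℂ → ℂ} (hh : IsExpKSeries k h) :
    ∃ A : ℂ → ℂ, DifferentiableOn ℂ A (ball 0 1) ∧ A 0 = 0 ∧
      ∀ z ∈ ball (0 : ℂ) 1, h z = exp (A (z ^ k)) := by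
  obtain ⟨a, ha⟩ := hh
  simp only [mul_comm _ k, pow_mul] at ha
  refine ⟨fun w => ∑' n : ℕ, a (k * (n + 1)) * w ^ (n + 1),
    differentiableOn_tsum_mul_pow fun w hw => ?_, by simp, fun z hz => ?_⟩
  · obtain ⟨z, hz, rfl⟩ := exists_mem_ball_pow_eq hk hw
    obtain ⟨s, hs, -⟩ := ha z hz
    exact hs.summable
  · obtain ⟨s, hs, hhs⟩ := ha z hz
    rw [hhs, ← hs.tsum_eq]

/-- The operator `z d/dz` on functions of `w = z ^ k`: it maps `A`, standing for `z ↦ A (z ^ k)`, to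
`k w A'`. -/
noncomputable def eulerDeriv (k : ℕ) (A : ℂ → ℂ) (w : ℂ) : ℂ := k * (w * deriv A w)

lemma eulerDeriv_zero (k : ℕ) (A : ℂ → ℂ) : eulerDeriv k A 0 = 0 := by
  rw [eulerDeriv, zero_mul, mul_zero]

lemma differentiableOn_eulerDeriv (k : ℕ) {A : ℂ → ℂ} (hA : DifferentiableOn ℂ A (ball 0 1)) :
    DifferentiableOn ℂ (eulerDeriv k A) (ball 0 1) :=
  (differentiableOn_id.mul (hA.deriv isOpen_ball)).const_mul _

/-- The normal form of the members of `S_LH^{k*}(α)`, in terms of the logarithms of `h` and `g`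
regarded as functions of `z ^ k`. -/
structure IsLogRepresentation (k : ℕ) (f A B : ℂ → ℂ) : Prop where
  differentiableOn_left : DifferentiableOn ℂ A (ball 0 1)
  differentiableOn_right : DifferentiableOn ℂ B (ball 0 1)
  map_zero_left : A 0 = 0
  map_zero_right : B 0 = 0
  eq_mul : ∀ z ∈ ball (0 : ℂ) 1, f z = z * exp (A (z ^ k)) * conj (exp (B (z ^ k)))

lemma SLHkStar.exists_isLogRepresentation {k : ℕ} {α : ℝ} {f : ℂ → ℂ} (hk : 1 ≤ k)
    (hf : SLHkStar k α f) : ∃ A B, IsLogRepresentation k f A B := by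
  obtain ⟨h, g, -, -, hh, hg, hfhg⟩ := hf.form
  obtain ⟨A, hA, hA0, hhA⟩ := hh.exists_eq_exp hk
  obtain ⟨B, hB, hB0, hgB⟩ := hg.exists_eq_exp hk
  exact ⟨A, B, hA, hB, hA0, hB0, fun z hz => by rw [hfhg z hz, hhA z hz, hgB z hz]⟩

namespace IsLogRepresentation

variable {k : ℕ} {α : ℝ} {f A B : ℂ → ℂ} {z : ℂ}

lemma ne_zero (h : IsLogRepresentation k f A B) (hz : z ∈ ball (0 : ℂ) 1) (hz0 : z ≠ 0) :
    f z ≠ 0 := by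
  rw [h.eq_mul z hz]
  exact mul_ne_zero (mul_ne_zero hz0 (exp_ne_zero _)) (star_ne_zero.2 (exp_ne_zero _))

lemma eventuallyEq (h : IsLogRepresentation k f A B) (hz : z ∈ ball (0 : ℂ) 1) :
    f =ᶠ[𝓝 z] fun x => x * exp (A (x ^ k)) * conj (exp (B (x ^ k))) :=
  Filter.eventuallyEq_of_mem (isOpen_ball.mem_nhds hz) h.eq_mul

lemma hasDerivAt_exp_left (hk : 1 ≤ k) (h : IsLogRepresentation k f A B)
    (hz : z ∈ ball (0 : ℂ) 1) :
    HasDerivAt (fun x => x * exp (A (x ^ k)))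
      (exp (A (z ^ k)) * (1 + eulerDeriv k A (z ^ k))) z := by
  have hA := (h.differentiableOn_left.differentiableAt
    (isOpen_ball.mem_nhds ((pow_mem_ball_zero_one_iff hk).2 hz))).hasDerivAt
  refine ((hasDerivAt_id' z).mul (hA.comp z (hasDerivAt_pow k z)).cexp).congr_deriv ?_
  rw [eulerDeriv, Function.comp_apply]
  linear_combination exp (A (z ^ k)) * deriv A (z ^ k) * k *
    mul_pow_sub_one (by lia : k ≠ 0) z

lemma hasDerivAt_exp_right (hk : 1 ≤ k) (h : IsLogRepresentation k f A B)
    (hz : z ∈ ball (0 : ℂ) 1) :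
    HasDerivAt (fun x => exp (B (x ^ k)))
      (exp (B (z ^ k)) * (deriv B (z ^ k) * (k * z ^ (k - 1)))) z :=
  ((h.differentiableOn_right.differentiableAt (isOpen_ball.mem_nhds
    ((pow_mem_ball_zero_one_iff hk).2 hz))).hasDerivAt.comp z (hasDerivAt_pow k z)).cexp

lemma differentiableAt (hk : 1 ≤ k) (h : IsLogRepresentation k f A B) (hz : z ∈ ball (0 : ℂ) 1) :
    DifferentiableAt ℝ f z :=
  (hasFDerivAt_mul_conj (h.hasDerivAt_exp_left hk hz)
    (h.hasDerivAt_exp_right hk hz)).differentiableAt.congr_of_eventuallyEq (h.eventuallyEq hz)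

lemma dz_eq (hk : 1 ≤ k) (h : IsLogRepresentation k f A B) (hz : z ∈ ball (0 : ℂ) 1) :
    dz f z = exp (A (z ^ k)) * (1 + eulerDeriv k A (z ^ k)) * conj (exp (B (z ^ k))) := by
  rw [← dz_mul_conj (h.hasDerivAt_exp_left hk hz) (h.hasDerivAt_exp_right hk hz), dz, dz,
    (h.eventuallyEq hz).fderiv_eq]

lemma dzbar_eq (hk : 1 ≤ k) (h : IsLogRepresentation k f A B) (hz : z ∈ ball (0 : ℂ) 1) :
    dzbar f z = z * exp (A (z ^ k)) *
      conj (exp (B (z ^ k)) * (deriv B (z ^ k) * (k * z ^ (k - 1)))) := by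
  rw [← dzbar_mul_conj (h.hasDerivAt_exp_left hk hz) (h.hasDerivAt_exp_right hk hz), dzbar, dzbar,
    (h.eventuallyEq hz).fderiv_eq]

lemma norm_dz (hk : 1 ≤ k) (h : IsLogRepresentation k f A B) (hz : z ∈ ball (0 : ℂ) 1) :
    ‖dz f z‖ = ‖exp (A (z ^ k) + B (z ^ k))‖ * ‖1 + eulerDeriv k A (z ^ k)‖ := by
  rw [h.dz_eq hk hz, Complex.exp_add]
  simp only [norm_mul, RCLike.norm_conj]
  ring

lemma norm_dzbar (hk : 1 ≤ k) (h : IsLogRepresentation k f A B) (hz : z ∈ ball (0 : ℂ) 1) :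
    ‖dzbar f z‖ = ‖exp (A (z ^ k) + B (z ^ k))‖ * ‖eulerDeriv k B (z ^ k)‖ := by
  have hpow : ‖z‖ * ‖z‖ ^ (k - 1) = ‖z‖ ^ k := mul_pow_sub_one (by lia) _
  rw [h.dzbar_eq hk hz, Complex.exp_add, eulerDeriv]
  simp only [norm_mul, RCLike.norm_conj, norm_pow, ← hpow]
  ring

lemma mul_dz_div (hk : 1 ≤ k) (h : IsLogRepresentation k f A B) (hz : z ∈ ball (0 : ℂ) 1)
    (hz0 : z ≠ 0) : z * dz f z / f z = 1 + eulerDeriv k A (z ^ k) := by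
  rw [div_eq_iff (h.ne_zero hz hz0), h.dz_eq hk hz, h.eq_mul z hz]
  ring

lemma conj_mul_dzbar_div (hk : 1 ≤ k) (h : IsLogRepresentation k f A B)
    (hz : z ∈ ball (0 : ℂ) 1) (hz0 : z ≠ 0) :
    conj z * dzbar f z / f z = conj (eulerDeriv k B (z ^ k)) := by
  rw [div_eq_iff (h.ne_zero hz hz0), h.dzbar_eq hk hz, h.eq_mul z hz, eulerDeriv,
    ← mul_pow_sub_one (by lia : k ≠ 0) z]
  simp only [map_mul]
  ring

lemma lt_re_sub (hk : 1 ≤ k) (h : IsLogRepresentation k f A B) (hf : IsStarlikeOfOrder α f)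
    (hz : z ∈ ball (0 : ℂ) 1) (hz0 : z ≠ 0) :
    α < (1 + eulerDeriv k A (z ^ k) - eulerDeriv k B (z ^ k)).re := by
  have := hf z hz hz0
  rwa [sub_div, h.mul_dz_div hk hz hz0, h.conj_mul_dzbar_div hk hz hz0, sub_re, conj_re,
    ← sub_re] at this

lemma exists_eulerDeriv_eq_mul (hk : 1 ≤ k) (h : IsLogRepresentation k f A B)
    (hf : IsLogharmonic f) (hz : z ∈ ball (0 : ℂ) 1) (hz0 : z ≠ 0) :
    ∃ ω : ℂ, ‖ω‖ < 1 ∧ eulerDeriv k B (z ^ k) = ω * (1 + eulerDeriv k A (z ^ k)) := by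
  obtain ⟨ω, -, hω1, hω⟩ := hf
  refine ⟨ω z, hω1 z hz, ?_⟩
  have hconj : eulerDeriv k B (z ^ k) = z * (conj (dzbar f z) / conj (f z)) := by
    rw [← conj_conj (eulerDeriv k B (z ^ k)), ← h.conj_mul_dzbar_div hk hz hz0, map_div₀, map_mul,
      conj_conj, mul_div_assoc]
  rw [hconj, (hω z hz (h.ne_zero hz hz0)).2, ← h.mul_dz_div hk hz hz0]
  ring

theorem isStarlikePair (hk : 1 ≤ k) (hα₀ : 0 ≤ α) (hα₁ : α < 1) (h : IsLogRepresentation k f A B)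
    (hlog : IsLogharmonic f) (hstar : IsStarlikeOfOrder α f) :
    IsStarlikePair α (fun w => 1 + eulerDeriv k A w) (eulerDeriv k B) := by
  have hlt : ∀ w ∈ ball (0 : ℂ) 1, α < (1 + eulerDeriv k A w - eulerDeriv k B w).re := by
    intro w hw
    obtain ⟨z, hz, rfl⟩ := exists_mem_ball_pow_eq hk hw
    rcases eq_or_ne z 0 with rfl | hz0
    · simpa [zero_pow (by lia : k ≠ 0), eulerDeriv_zero] using hα₁
    · exact h.lt_re_sub hk hstar hz hz0
  refine ⟨(differentiableOn_eulerDeriv k h.differentiableOn_left).const_add _,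
    differentiableOn_eulerDeriv k h.differentiableOn_right, by simp [eulerDeriv_zero],
    eulerDeriv_zero k B, hlt, fun w hw => ?_⟩
  have hre := hlt w hw
  obtain ⟨z, hz, rfl⟩ := exists_mem_ball_pow_eq hk hw
  rcases eq_or_ne z 0 with rfl | hz0
  · simp [zero_pow (by lia : k ≠ 0), eulerDeriv_zero]
  · obtain ⟨ω, hω1, hω⟩ := h.exists_eulerDeriv_eq_mul hk hlog hz hz0
    rw [hω, norm_mul]
    refine mul_lt_of_lt_one_left (norm_pos_iff.2 fun h0 => ?_) hω1
    rw [hω, h0, mul_zero, sub_zero, zero_re] at hre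
    exact hre.not_ge hα₀

lemma isRadialPrimitive (h : IsLogRepresentation k f A B) :
    IsRadialPrimitive (fun w => 1 + eulerDeriv k A w + eulerDeriv k B w)
      (fun w => k * (A w + B w)) where
  differentiableOn := (h.differentiableOn_left.add h.differentiableOn_right).const_mul _
  map_zero := by rw [h.map_zero_left, h.map_zero_right, add_zero, mul_zero]
  mul_deriv w hw := by
    have hw' := isOpen_ball.mem_nhds hw
    have hderiv := (((h.differentiableOn_left.differentiableAt hw').hasDerivAt.fun_add
      (h.differentiableOn_right.differentiableAt hw').hasDerivAt).const_mul (k : ℂ)).deriv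
    rw [hderiv, eulerDeriv, eulerDeriv]
    ring

end IsLogRepresentation

section Bounds

variable {k : ℕ} {α x : ℝ}

/-- The bound for `|h g|` at a point of modulus `ρ`: the upper bound at `x = ρ ^ k`, the lower bound
at `x = -ρ ^ k`. -/
noncomputable def growthBound (k : ℕ) (α x : ℝ) : ℝ :=
  Real.exp (4 * (1 - α) * x / (k * (1 - x))) / (1 - x) ^ (2 * α / k)

/-- The bound for `|f_z|` at a point of modulus `ρ`: the upper bound at `x = ρ ^ k`, the lower bound
at `x = -ρ ^ k`. -/
noncomputable def derivBound (k : ℕ) (α x : ℝ) : ℝ :=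
  (1 + (1 - 2 * α) * x) / (1 - x) ^ (2 * (α + k) / k) *
    Real.exp (4 * (1 - α) * x / (k * (1 - x)))

/-- The bound for the Jacobian of `f` at a point of modulus `ρ`: the upper bound at `x = ρ ^ k`, the
lower bound at `x = -ρ ^ k`. -/
noncomputable def jacobianBound (k : ℕ) (α x : ℝ) : ℝ :=
  derivBound k α x ^ 2 - (x * derivBound k α (-x)) ^ 2

lemma growthBound_eq_exp (hx : x < 1) : growthBound k α x =
    Real.exp ((4 * (1 - α) * x / (1 - x) - 2 * α * Real.log (1 - x)) / k) := by
  rw [growthBound, Real.rpow_def_of_pos (sub_pos.2 hx), ← Real.exp_sub, sub_div, div_div,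
    mul_comm (1 - x)]
  congr 1
  ring

lemma growthBound_nonneg (hx : x < 1) : 0 ≤ growthBound k α x := by
  rw [growthBound_eq_exp hx]
  exact (Real.exp_pos _).le

lemma derivBound_eq_growthBound_mul (hk : 1 ≤ k) (hx : x < 1) :
    derivBound k α x = growthBound k α x * ((1 + (1 - 2 * α) * x) / (1 - x) ^ 2) := by
  have hk0 : (k : ℝ) ≠ 0 := by exact_mod_cast (by lia : k ≠ 0)
  have hexp : 2 * (α + k) / k = 2 * α / k + 2 := by field_simp
  rw [derivBound, growthBound, hexp, Real.rpow_add (sub_pos.2 hx), Real.rpow_ofNat,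
    div_mul_div_comm, div_mul_eq_mul_div, mul_comm (Real.exp _)]

lemma sq_derivBound (k : ℕ) (α x : ℝ) : derivBound k α x ^ 2 =
    ((1 + (1 - 2 * α) * x) / (1 - x) ^ (2 * (α + k) / k)) ^ 2 *
      Real.exp (8 * (1 - α) * x / (k * (1 - x))) := by
  rw [derivBound, mul_pow, ← Real.exp_nat_mul]
  congr 2
  push_cast
  ring

lemma derivBound_nonneg (hk : 1 ≤ k) (hα₀ : 0 ≤ α) (hα₁ : α ≤ 1) (hx : x ∈ Ioo (-1 : ℝ) 1) :
    0 ≤ derivBound k α x := by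
  rw [derivBound_eq_growthBound_mul hk hx.2]
  have : 0 ≤ 1 + (1 - 2 * α) * x := by
    nlinarith [mul_nonneg hα₀ (sub_nonneg.2 hx.2.le),
      mul_nonneg (sub_nonneg.2 hα₁) (neg_le_iff_add_nonneg.1 hx.1.le)]
  exact mul_nonneg (growthBound_nonneg hx.2) (by positivity)

lemma continuousOn_derivBound (hk : 1 ≤ k) (α : ℝ) : ContinuousOn (derivBound k α) (Iio 1) := by
  have hk0 : (k : ℝ) ≠ 0 := by exact_mod_cast (by lia : k ≠ 0)
  have hpos (x : ℝ) (hx : x ∈ Iio (1 : ℝ)) : 0 < 1 - x := sub_pos.2 hx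
  unfold derivBound
  refine (ContinuousOn.div (by fun_prop) (ContinuousOn.rpow_const (by fun_prop)
    fun x hx => .inl (hpos x hx).ne') fun x hx => (Real.rpow_pos_of_pos (hpos x hx) _).ne').mul
    (ContinuousOn.rexp (ContinuousOn.div (by fun_prop) (by fun_prop)
      fun x hx => mul_ne_zero hk0 (hpos x hx).ne'))

lemma continuousOn_derivBound_neg (hk : 1 ≤ k) (α : ℝ) :
    ContinuousOn (fun x => x * derivBound k α (-x)) (Ioi (-1)) :=
  continuousOn_id.mul ((continuousOn_derivBound hk α).comp continuousOn_neg
    fun _ hx => mem_Iio.2 (neg_lt.1 hx))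

lemma continuousOn_jacobianBound (hk : 1 ≤ k) (α : ℝ) :
    ContinuousOn (jacobianBound k α) (Ioo (-1) 1) :=
  (((continuousOn_derivBound hk α).mono Ioo_subset_Iio_self).pow 2).sub
    (((continuousOn_derivBound_neg hk α).mono Ioo_subset_Ioi_self).pow 2)

lemma integral_jacobianBound {σ : ℝ → ℝ} {a b : ℝ} (hk : 1 ≤ k) (α : ℝ)
    (hσ : ContinuousOn σ (uIcc a b)) (hmem : MapsTo σ (uIcc a b) (Ioo (-1) 1)) :
    ∫ ρ in a..b, jacobianBound k α (σ ρ) * ρ =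
      (∫ ρ in a..b, derivBound k α (σ ρ) ^ 2 * ρ) -
        ∫ ρ in a..b, (σ ρ * derivBound k α (-σ ρ)) ^ 2 * ρ := by
  have h₁ : ContinuousOn (fun ρ => derivBound k α (σ ρ) ^ 2 * ρ) (uIcc a b) :=
    (((continuousOn_derivBound hk α).comp hσ fun _ hρ => (hmem hρ).2).pow 2).mul continuousOn_id
  have h₂ : ContinuousOn (fun ρ => (σ ρ * derivBound k α (-σ ρ)) ^ 2 * ρ) (uIcc a b) :=
    (((continuousOn_derivBound_neg hk α).comp hσ fun _ hρ => (hmem hρ).1).pow 2).mul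
      continuousOn_id
  simp only [jacobianBound, sub_mul]
  exact intervalIntegral.integral_sub h₁.intervalIntegrable h₂.intervalIntegrable

variable {r ρ : ℝ}

lemma pow_mem_Ioo (hk : 1 ≤ k) (hr₁ : r < 1) (hρ : ρ ∈ Icc 0 r) : ρ ^ k ∈ Ioo (-1 : ℝ) 1 :=
  ⟨by linarith [pow_nonneg hρ.1 k], pow_lt_one₀ hρ.1 (hρ.2.trans_lt hr₁) (by lia)⟩

lemma neg_pow_mem_Ioo (hk : 1 ≤ k) (hr₁ : r < 1) (hρ : ρ ∈ Icc 0 r) :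
    -ρ ^ k ∈ Ioo (-1 : ℝ) 1 :=
  ⟨neg_lt_neg (pow_mem_Ioo hk hr₁ hρ).2, by linarith [pow_nonneg hρ.1 k]⟩

lemma L₁_eq_integral_jacobianBound (hk : 1 ≤ k) (α : ℝ) (hr₀ : 0 ≤ r) (hr₁ : r < 1) :
    L₁ k α r = ∫ ρ in (0 : ℝ)..r, jacobianBound k α (-ρ ^ k) * ρ := by
  rw [integral_jacobianBound hk α (by fun_prop) fun ρ hρ =>
    neg_pow_mem_Ioo hk hr₁ (by rwa [uIcc_of_le hr₀] at hρ), L₁]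
  simp only [mul_pow, neg_sq, neg_neg, sq_derivBound, sub_neg_eq_add, mul_neg, ← sub_eq_add_neg,
    mul_div_assoc, neg_mul, mul_assoc]

lemma L₂_eq_integral_jacobianBound (hk : 1 ≤ k) (α : ℝ) (hr₀ : 0 ≤ r) (hr₁ : r < 1) :
    L₂ k α r = ∫ ρ in (0 : ℝ)..r, jacobianBound k α (ρ ^ k) * ρ := by
  rw [integral_jacobianBound hk α (by fun_prop) fun ρ hρ =>
    pow_mem_Ioo hk hr₁ (by rwa [uIcc_of_le hr₀] at hρ), L₂]
  simp only [mul_pow, sq_derivBound, sub_neg_eq_add, mul_neg, ← sub_eq_add_neg, mul_div_assoc,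
    neg_mul, mul_assoc]

end Bounds

namespace IsLogRepresentation

variable {k : ℕ} {α : ℝ} {f A B : ℂ → ℂ} {w z : ℂ}

lemma norm_exp_le (hk : 1 ≤ k) (hα : 0 ≤ α) (h : IsLogRepresentation k f A B)
    (hs : IsStarlikePair α (fun w => 1 + eulerDeriv k A w) (eulerDeriv k B))
    (hw : w ∈ ball (0 : ℂ) 1) : ‖exp (A w + B w)‖ ≤ growthBound k α ‖w‖ := by
  have := hs.isCaratheodory_sub.re_primitive_mul_le hα hs.isCaratheodory_add_div_sub
    (hs.isRadialPrimitive_sub_mul h.isRadialPrimitive) hw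
  rw [← ofReal_natCast, re_ofReal_mul] at this
  rw [norm_exp, growthBound_eq_exp (mem_ball_zero_iff.1 hw), Real.exp_le_exp,
    le_div_iff₀' (by exact_mod_cast hk)]
  exact this

lemma le_norm_exp (hk : 1 ≤ k) (hα : 0 ≤ α) (h : IsLogRepresentation k f A B)
    (hs : IsStarlikePair α (fun w => 1 + eulerDeriv k A w) (eulerDeriv k B))
    (hw : w ∈ ball (0 : ℂ) 1) : growthBound k α (-‖w‖) ≤ ‖exp (A w + B w)‖ := by
  have := hs.isCaratheodory_sub.le_re_primitive_mul hα hs.isCaratheodory_add_div_sub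
    (hs.isRadialPrimitive_sub_mul h.isRadialPrimitive) hw
  rw [← ofReal_natCast, re_ofReal_mul] at this
  rw [norm_exp, growthBound_eq_exp (by linarith [norm_nonneg w]), Real.exp_le_exp,
    div_le_iff₀' (by exact_mod_cast hk), sub_neg_eq_add, mul_neg, neg_div]
  exact this

lemma le_norm_dz (hk : 1 ≤ k) (hα : 0 ≤ α) (h : IsLogRepresentation k f A B)
    (hs : IsStarlikePair α (fun w => 1 + eulerDeriv k A w) (eulerDeriv k B))
    (hz : z ∈ ball (0 : ℂ) 1) : derivBound k α (-‖z ^ k‖) ≤ ‖dz f z‖ := by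
  have hw := (pow_mem_ball_zero_one_iff hk).2 hz
  have hlt : -‖z ^ k‖ < 1 := by linarith [norm_nonneg (z ^ k)]
  have hH := hs.le_norm_left hw
  rw [h.norm_dz hk hz, derivBound_eq_growthBound_mul hk hlt,
    sub_neg_eq_add, mul_neg, ← sub_eq_add_neg]
  exact mul_le_mul_of_nonneg (h.le_norm_exp hk hα hs hw) hH (growthBound_nonneg hlt) (norm_nonneg _)

lemma norm_dzbar_le (hk : 1 ≤ k) (hα : 0 ≤ α) (h : IsLogRepresentation k f A B)
    (hs : IsStarlikePair α (fun w => 1 + eulerDeriv k A w) (eulerDeriv k B))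
    (hz : z ∈ ball (0 : ℂ) 1) : ‖dzbar f z‖ ≤ ‖z ^ k‖ * derivBound k α ‖z ^ k‖ := by
  have hw := (pow_mem_ball_zero_one_iff hk).2 hz
  have hw' := mem_ball_zero_iff.1 hw
  rw [h.norm_dzbar hk hz, derivBound_eq_growthBound_mul hk hw', mul_left_comm]
  exact mul_le_mul (h.norm_exp_le hk hα hs hw) (hs.norm_right_le hw) (norm_nonneg _)
    (growthBound_nonneg hw')

lemma det_fderiv_eq (hk : 1 ≤ k) (h : IsLogRepresentation k f A B) (hz : z ∈ ball (0 : ℂ) 1) :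
    (fderiv ℝ f z).det = ‖exp (A (z ^ k) + B (z ^ k))‖ ^ 2 *
      (‖1 + eulerDeriv k A (z ^ k)‖ ^ 2 - ‖eulerDeriv k B (z ^ k)‖ ^ 2) := by
  rw [det_fderiv_eq_sq_norm_dz_sub_sq_norm_dzbar, h.norm_dz hk hz, h.norm_dzbar hk hz]
  ring

lemma det_fderiv_nonneg (hk : 1 ≤ k) (h : IsLogRepresentation k f A B)
    (hs : IsStarlikePair α (fun w => 1 + eulerDeriv k A w) (eulerDeriv k B))
    (hz : z ∈ ball (0 : ℂ) 1) : 0 ≤ (fderiv ℝ f z).det := by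
  rw [h.det_fderiv_eq hk hz]
  have hlt := hs.norm_lt_norm _ ((pow_mem_ball_zero_one_iff hk).2 hz)
  exact mul_nonneg (sq_nonneg _)
    (sub_nonneg.2 (pow_le_pow_left₀ (norm_nonneg _) hlt.le 2))

lemma jacobianBound_neg_le_det_fderiv (hk : 1 ≤ k) (hα₀ : 0 ≤ α) (hα₁ : α ≤ 1)
    (h : IsLogRepresentation k f A B)
    (hs : IsStarlikePair α (fun w => 1 + eulerDeriv k A w) (eulerDeriv k B))
    (hz : z ∈ ball (0 : ℂ) 1) : jacobianBound k α (-‖z ^ k‖) ≤ (fderiv ℝ f z).det := by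
  have hmem : -‖z ^ k‖ ∈ Ioo (-1 : ℝ) 1 :=
    ⟨neg_lt_neg (norm_pow_mem_Ioo hk hz).2, by linarith [norm_nonneg (z ^ k)]⟩
  rw [det_fderiv_eq_sq_norm_dz_sub_sq_norm_dzbar, jacobianBound, neg_neg, neg_mul, neg_sq]
  exact sub_le_sub
    (pow_le_pow_left₀ (derivBound_nonneg hk hα₀ hα₁ hmem) (h.le_norm_dz hk hα₀ hs hz) 2)
    (pow_le_pow_left₀ (norm_nonneg _) (h.norm_dzbar_le hk hα₀ hs hz) 2)

lemma det_fderiv_le (hk : 1 ≤ k) (hα : 0 ≤ α) (h : IsLogRepresentation k f A B)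
    (hs : IsStarlikePair α (fun w => 1 + eulerDeriv k A w) (eulerDeriv k B))
    (hz : z ∈ ball (0 : ℂ) 1) :
    (fderiv ℝ f z).det ≤ derivBound k α ‖z ^ k‖ ^ 2 * (1 - ‖z ^ k‖ ^ 2) := by
  have hw := (pow_mem_ball_zero_one_iff hk).2 hz
  have hHG := hs.sq_norm_sub_sq_norm_le hw
  have hlt := mem_ball_zero_iff.1 hw
  have hsq : 0 ≤ 1 - ‖z ^ k‖ ^ 2 := by nlinarith [norm_nonneg (z ^ k)]
  rw [h.det_fderiv_eq hk hz, derivBound_eq_growthBound_mul hk hlt, mul_pow, mul_assoc]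
  refine (mul_le_mul_of_nonneg_left hHG (sq_nonneg _)).trans ?_
  gcongr
  exact h.norm_exp_le hk hα hs hw

/-- `|f_z̄|` has no lower bound complementing `le_norm_dz`, since it may vanish; the subtracted term
comes from the stronger bound `det_fderiv_le`. -/
lemma det_fderiv_le_jacobianBound (hk : 1 ≤ k) (hα₀ : 0 ≤ α) (hα₁ : α ≤ 1)
    (h : IsLogRepresentation k f A B)
    (hs : IsStarlikePair α (fun w => 1 + eulerDeriv k A w) (eulerDeriv k B))
    (hz : z ∈ ball (0 : ℂ) 1) : (fderiv ℝ f z).det ≤ jacobianBound k α ‖z ^ k‖ := by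
  have hle := h.det_fderiv_le hk hα₀ hs hz
  have hge := h.jacobianBound_neg_le_det_fderiv hk hα₀ hα₁ hs hz
  rw [jacobianBound, neg_neg, neg_mul, neg_sq] at hge
  have hsq : derivBound k α (-‖z ^ k‖) ^ 2 ≤ derivBound k α ‖z ^ k‖ ^ 2 := by linarith
  rw [jacobianBound]
  linarith [mul_le_mul_of_nonneg_left hsq (sq_nonneg ‖z ^ k‖)]

end IsLogRepresentation

section Area

variable {V : Type*} [NormedAddCommGroup V] [NormedSpace ℝ V] [FiniteDimensional ℝ V]
  [MeasurableSpace V] [BorelSpace V] {μ : Measure V} [μ.IsAddHaarMeasure] {s : Set V} {f : V → V}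
  {f' : V → V →L[ℝ] V} {φ : V → ℝ}

lemma measure_image_ne_top_of_abs_det_le (hs : MeasurableSet s)
    (hf' : ∀ x ∈ s, HasFDerivWithinAt f (f' x) s x) (hf : InjOn f s) (hφ : IntegrableOn φ s μ)
    (hle : ∀ x ∈ s, |(f' x).det| ≤ φ x) : μ (f '' s) ≠ ⊤ := by
  rw [← lintegral_abs_det_fderiv_eq_addHaar_image μ hs hf' hf]
  refine ((setLIntegral_mono' hs fun x hx => ENNReal.ofReal_le_ofReal (hle x hx)).trans_lt ?_).ne
  exact hφ.lintegral_lt_top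

lemma integrableOn_abs_det (hs : MeasurableSet s)
    (hf' : ∀ x ∈ s, HasFDerivWithinAt f (f' x) s x) (hf : InjOn f s) (hfin : μ (f '' s) ≠ ⊤) :
    IntegrableOn (fun x => |(f' x).det|) s μ := by
  simpa using (integrableOn_image_iff_integrableOn_abs_det_fderiv_smul μ hs hf' hf
    (fun _ => (1 : ℝ))).1 (integrableOn_const hfin)

lemma integral_abs_det_eq_toReal_measure_image (hs : MeasurableSet s)
    (hf' : ∀ x ∈ s, HasFDerivWithinAt f (f' x) s x) (hf : InjOn f s) :
    ∫ x in s, |(f' x).det| ∂μ = (μ (f '' s)).toReal := by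
  simpa [Measure.real] using
    (integral_image_eq_integral_abs_det_fderiv_smul μ hs hf' hf (fun _ => (1 : ℝ))).symm

end Area

lemma integrableOn_ball_fun_norm {V : Type*} [NormedAddCommGroup V] [ProperSpace V]
    [MeasurableSpace V] [OpensMeasurableSpace V] {μ : Measure V} [IsFiniteMeasureOnCompacts μ]
    {r : ℝ} {φ : ℝ → ℝ} (hφ : ContinuousOn φ (Icc 0 r)) :
    IntegrableOn (fun z => φ ‖z‖) (ball 0 r) μ := by
  have h : ContinuousOn (fun z : V => φ ‖z‖) (closedBall 0 r) :=
    hφ.comp (by fun_prop) fun z hz => ⟨norm_nonneg z, mem_closedBall_zero_iff.1 hz⟩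
  exact (h.integrableOn_compact (isCompact_closedBall 0 r)).mono_set ball_subset_closedBall

lemma setIntegral_ball_fun_norm {r : ℝ} (hr : 0 ≤ r) (φ : ℝ → ℝ) :
    ∫ z in ball (0 : ℂ) r, φ ‖z‖ = 2 * π * ∫ ρ in (0 : ℝ)..r, φ ρ * ρ := by
  have hind : ∫ z in ball (0 : ℂ) r, φ ‖z‖ = ∫ z : ℂ, (Iio r).indicator φ ‖z‖ := by
    rw [← integral_indicator measurableSet_ball]
    congr 1
    ext z
    simp [indicator]
  have hradial (y : ℝ) : y ^ (2 - 1) • (Iio r).indicator φ y =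
      (Iio r).indicator (fun ρ => φ ρ * ρ) y := by
    by_cases h : y ∈ Iio r <;> simp [h, mul_comm]
  rw [hind, integral_fun_norm_addHaar volume ((Iio r).indicator φ), finrank_real_complex,
    intervalIntegral.integral_of_le hr, integral_Ioc_eq_integral_Ioo]
  simp only [hradial]
  rw [setIntegral_indicator measurableSet_Iio, Ioi_inter_Iio]
  simp only [Measure.real, Complex.volume_ball, ENNReal.ofReal_one, one_pow, one_mul,
    ENNReal.coe_toReal, NNReal.coe_real_pi, smul_eq_mul, nsmul_eq_mul, Nat.cast_ofNat]
  ring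

section RadialArea

variable {f : ℂ → ℂ} {f' : ℂ → ℂ →L[ℝ] ℂ} {φ : ℝ → ℝ} {r : ℝ}

lemma volume_image_ball_ne_top (hf : InjOn f (ball 0 r))
    (hf' : ∀ z ∈ ball (0 : ℂ) r, HasFDerivAt f (f' z) z) (hφ : ContinuousOn φ (Icc 0 r))
    (hle : ∀ z ∈ ball (0 : ℂ) r, |(f' z).det| ≤ φ ‖z‖) : volume (f '' ball 0 r) ≠ ⊤ :=
  measure_image_ne_top_of_abs_det_le measurableSet_ball
    (fun z hz => (hf' z hz).hasFDerivWithinAt) hf (integrableOn_ball_fun_norm hφ) hle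

lemma toReal_volume_image_ball_le (hr : 0 ≤ r) (hf : InjOn f (ball 0 r))
    (hf' : ∀ z ∈ ball (0 : ℂ) r, HasFDerivAt f (f' z) z) (hφ : ContinuousOn φ (Icc 0 r))
    (hle : ∀ z ∈ ball (0 : ℂ) r, |(f' z).det| ≤ φ ‖z‖) :
    (volume (f '' ball 0 r)).toReal ≤ 2 * π * ∫ ρ in (0 : ℝ)..r, φ ρ * ρ := by
  have hf'' : ∀ z ∈ ball (0 : ℂ) r, HasFDerivWithinAt f (f' z) (ball 0 r) z :=
    fun z hz => (hf' z hz).hasFDerivWithinAt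
  rw [← integral_abs_det_eq_toReal_measure_image measurableSet_ball hf'' hf,
    ← setIntegral_ball_fun_norm hr]
  exact setIntegral_mono_on (integrableOn_abs_det measurableSet_ball hf'' hf
    (volume_image_ball_ne_top hf hf' hφ hle)) (integrableOn_ball_fun_norm hφ) measurableSet_ball hle

lemma le_toReal_volume_image_ball (hr : 0 ≤ r) (hf : InjOn f (ball 0 r))
    (hf' : ∀ z ∈ ball (0 : ℂ) r, HasFDerivAt f (f' z) z) (hφ : ContinuousOn φ (Icc 0 r))
    (hfin : volume (f '' ball 0 r) ≠ ⊤) (hle : ∀ z ∈ ball (0 : ℂ) r, φ ‖z‖ ≤ |(f' z).det|) :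
    2 * π * ∫ ρ in (0 : ℝ)..r, φ ρ * ρ ≤ (volume (f '' ball 0 r)).toReal := by
  have hf'' : ∀ z ∈ ball (0 : ℂ) r, HasFDerivWithinAt f (f' z) (ball 0 r) z :=
    fun z hz => (hf' z hz).hasFDerivWithinAt
  rw [← integral_abs_det_eq_toReal_measure_image measurableSet_ball hf'' hf,
    ← setIntegral_ball_fun_norm hr]
  exact setIntegral_mono_on (integrableOn_ball_fun_norm hφ)
    (integrableOn_abs_det measurableSet_ball hf'' hf hfin) measurableSet_ball hle

end RadialArea

namespace SLHkStar

variable {k : ℕ} {α : ℝ} {f : ℂ → ℂ} {z : ℂ}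

theorem hasFDerivAt (hk : 1 ≤ k) (hf : SLHkStar k α f) (hz : z ∈ ball (0 : ℂ) 1) :
    HasFDerivAt f (fderiv ℝ f z) z := by
  obtain ⟨A, B, h⟩ := hf.exists_isLogRepresentation hk
  exact (h.differentiableAt hk hz).hasFDerivAt

theorem abs_det_fderiv_mem_Icc (hk : 1 ≤ k) (hα₀ : 0 ≤ α) (hα₁ : α < 1) (hf : SLHkStar k α f)
    (hz : z ∈ ball (0 : ℂ) 1) : |(fderiv ℝ f z).det| ∈
      Icc (jacobianBound k α (-‖z‖ ^ k)) (jacobianBound k α (‖z‖ ^ k)) := by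
  obtain ⟨A, B, h⟩ := hf.exists_isLogRepresentation hk
  have hs := h.isStarlikePair hk hα₀ hα₁ hf.logharmonic hf.starlike
  rw [abs_of_nonneg (h.det_fderiv_nonneg hk hs hz), ← norm_pow]
  exact ⟨h.jacobianBound_neg_le_det_fderiv hk hα₀ hα₁.le hs hz,
    h.det_fderiv_le_jacobianBound hk hα₀ hα₁.le hs hz⟩

end SLHkStar

end Logharmonic

open Logharmonic

theorem mainTheorem7 (k : ℕ) (hk : 1 ≤ k) (α : ℝ) (hα₀ : 0 ≤ α) (hα₁ : α < 1)
    (f : ℂ → ℂ) (hf : Logharmonic.SLHkStar k α f) (r : ℝ) (hr₀ : 0 ≤ r) (hr₁ : r < 1) :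
    MeasureTheory.volume (f '' Metric.ball (0 : ℂ) r) ≠ ⊤ ∧
      2 * Real.pi * Logharmonic.L₁ k α r ≤
        (MeasureTheory.volume (f '' Metric.ball (0 : ℂ) r)).toReal ∧
      (MeasureTheory.volume (f '' Metric.ball (0 : ℂ) r)).toReal ≤
        2 * Real.pi * Logharmonic.L₂ k α r := by
  have hsub : ball (0 : ℂ) r ⊆ ball 0 1 := ball_subset_ball hr₁.le
  have hinj : InjOn f (ball 0 r) := hf.univalent.mono hsub
  have hf' : ∀ z ∈ ball (0 : ℂ) r, HasFDerivAt f (fderiv ℝ f z) z :=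
    fun z hz => hf.hasFDerivAt hk (hsub hz)
  have hJ := fun z (hz : z ∈ ball (0 : ℂ) r) => hf.abs_det_fderiv_mem_Icc hk hα₀ hα₁ (hsub hz)
  have hupper : ContinuousOn (fun ρ => jacobianBound k α (ρ ^ k)) (Icc 0 r) :=
    (continuousOn_jacobianBound hk α).comp (by fun_prop) fun _ => pow_mem_Ioo hk hr₁
  have hlower : ContinuousOn (fun ρ => jacobianBound k α (-ρ ^ k)) (Icc 0 r) :=
    (continuousOn_jacobianBound hk α).comp (by fun_prop) fun _ => neg_pow_mem_Ioo hk hr₁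
  have hfin := volume_image_ball_ne_top hinj hf' hupper fun z hz => (hJ z hz).2
  rw [L₁_eq_integral_jacobianBound hk α hr₀ hr₁, L₂_eq_integral_jacobianBound hk α hr₀ hr₁]
  exact ⟨hfin, le_toReal_volume_image_ball hr₀ hinj hf' hlower hfin fun z hz => (hJ z hz).1,
    toReal_volume_image_ball_le hr₀ hinj hf' hupper fun z hz => (hJ z hz).2⟩
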